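/- Let $M$ be a real (smooth) $5$-dimensional manifold endowed with a Lorentzian metric $g$ of signature $(-,+,+,+,+)$, let $p\in M$, and let $R$ be a real symmetric covariant two-tensor at $p$. Let $R^a{}_b$ be its mixed form, that is, the linear operator $A:T_pM\to T_pM$ determined by $g(Av,u)=R(u,v)$ for all $u,v\in T_pM$. A nonzero real vector $v\in T_pM$ is called time-like, null or space-like according as $g(v,v)<0$, $g(v,v)=0$ or $g(v,v)>0$; eigenvectors below are real vectors in $T_pM$ with real eigenvalue, a null eigendirection is a line spanned by a null eigenvector, and "all eigenvalues are real" refers to the eigenvalues of the complexification of $A$. Then: 1. $R^a{}_b$ has a time-like eigenvector if and only if it is diagonalizable over $\mathbb{R}$. 2. $R^a{}_b$ has at least three linearly independent, mutually orthogonal real eigenvectors, at least two of which are space-like. 3. All eigenvalues of $R^a{}_b$ are real and $R^a{}_b$ is not diagonalizable if and only if $R^a{}_b$ has exactly one null eigendirection. 4. If $R^a{}_b$ has two linearly independent null eigenvectors, then it is diagonalizable over $\mathbb{R}$ and its eigenvalues are real. -/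

import Mathlib

open scoped Manifold ContDiff

namespace SegreFive

section Algebra

variable {V : Type*} [AddCommGroup V] [Module ℝ V]

/-- A bilinear form on a real vector space has signature `(- + + + +)`: in a suitable basis
(a Lorentz pentad) its matrix is `diag(-1, 1, 1, 1, 1)`. In particular `V` has dimension 5. -/
def HasLorentzSignature (g : LinearMap.BilinForm ℝ V) : Prop :=
  ∃ e : Module.Basis (Fin 5) ℝ V,
    ∀ i j, g (e i) (e j) = if i = j then (if i = 0 then -1 else 1) else 0

theorem HasLorentzSignature.finiteDimensional {g : LinearMap.BilinForm ℝ V}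
    (hg : HasLorentzSignature g) : FiniteDimensional ℝ V := by
  obtain ⟨e, _⟩ := hg
  exact Module.Finite.of_basis e

theorem HasLorentzSignature.nondegenerate {g : LinearMap.BilinForm ℝ V}
    (hg : HasLorentzSignature g) : g.Nondegenerate := by
  obtain ⟨e, he⟩ := hg
  refine LinearMap.IsOrthoᵢ.nondegenerate_of_not_isOrtho_basis_self e ?_ ?_
  · intro i j hij
    show g (e i) (e j) = 0
    rw [he, if_neg hij]
  · intro i h
    have h' : g (e i) (e i) = 0 := h
    rw [he, if_pos rfl] at h'
    split_ifs at h' <;> norm_num at h'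

/-- The mixed form `R^a_b = g^{ac} R_{cb}` of a covariant two-tensor `R`: the linear operator on
`V` obtained by raising the first index of `R` with the metric `g`. -/
noncomputable def mixed (g : LinearMap.BilinForm ℝ V) (hg : HasLorentzSignature g)
    (R : LinearMap.BilinForm ℝ V) : Module.End ℝ V :=
  haveI := hg.finiteDimensional
  (g.toDual hg.nondegenerate).symm.toLinearMap ∘ₗ R.flip

/-- The defining relation `g_{ac} R^c_b = R_{ab}`. -/
theorem mixed_spec (g : LinearMap.BilinForm ℝ V) (hg : HasLorentzSignature g)
    (R : LinearMap.BilinForm ℝ V) (u v : V) : g (mixed g hg R v) u = R u v := by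
  have := hg.finiteDimensional
  simp [mixed]

/-- `v` is a (real) eigenvector of `A`, with some real eigenvalue. -/
def IsEigenvector (A : Module.End ℝ V) (v : V) : Prop :=
  ∃ μ : ℝ, A.HasEigenvector μ v

def IsTimelike (g : LinearMap.BilinForm ℝ V) (v : V) : Prop := g v v < 0

def IsSpacelike (g : LinearMap.BilinForm ℝ V) (v : V) : Prop := 0 < g v v

/-- Null vectors are nonzero by convention. -/
def IsNull (g : LinearMap.BilinForm ℝ V) (v : V) : Prop := v ≠ 0 ∧ g v v = 0

/-- `A` is diagonalizable over `ℝ`: some real basis consists of eigenvectors of `A`. -/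
def IsDiagonalizable (A : Module.End ℝ V) : Prop :=
  ∃ b : Module.Basis (Fin (Module.finrank ℝ V)) ℝ V, ∀ i, IsEigenvector A (b i)

/-- All complex eigenvalues of the real operator `A` (that is, the eigenvalues of its
complexification) are real. -/
def AllEigenvaluesReal (A : Module.End ℝ V) : Prop :=
  ∀ z : ℂ, Module.End.HasEigenvalue (LinearMap.baseChange ℂ A) z → z.im = 0

/-- A null eigendirection of `A`: a line spanned by a null eigenvector. -/
def IsNullEigendirection (g : LinearMap.BilinForm ℝ V) (A : Module.End ℝ V)
    (L : Submodule ℝ V) : Prop :=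
  ∃ k : V, IsNull g k ∧ IsEigenvector A k ∧ L = Submodule.span ℝ {k}

end Algebra

section Manifold

/-- A smooth Lorentzian metric of signature `(- + + + +)` on a smooth 5-manifold. -/
structure LorentzianMetric (M : Type*) [TopologicalSpace M]
    [ChartedSpace (EuclideanSpace ℝ (Fin 5)) M] [IsManifold (𝓡 5) ∞ M] where
  val (p : M) : TangentSpace (𝓡 5) p →L[ℝ] TangentSpace (𝓡 5) p →L[ℝ] ℝ
  symm (p : M) (u v : TangentSpace (𝓡 5) p) : val p u v = val p v u
  signature (p : M) : HasLorentzSignature (val p).toBilinForm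
  contMDiff : ContMDiff (𝓡 5)
    ((𝓡 5).prod 𝓘(ℝ, EuclideanSpace ℝ (Fin 5) →L[ℝ] EuclideanSpace ℝ (Fin 5) →L[ℝ] ℝ)) ∞
    (fun p ↦ Bundle.TotalSpace.mk'
      (EuclideanSpace ℝ (Fin 5) →L[ℝ] EuclideanSpace ℝ (Fin 5) →L[ℝ] ℝ)
      (E := fun p : M ↦ TangentSpace (𝓡 5) p →L[ℝ] TangentSpace (𝓡 5) p →L[ℝ] ℝ) p (val p))

variable {M : Type*} [TopologicalSpace M]
  [ChartedSpace (EuclideanSpace ℝ (Fin 5)) M] [IsManifold (𝓡 5) ∞ M]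

/-- The metric at `p` as a bilinear form on the tangent space. -/
noncomputable def LorentzianMetric.form (g : LorentzianMetric M) (p : M) :
    LinearMap.BilinForm ℝ (TangentSpace (𝓡 5) p) :=
  (g.val p).toBilinForm

/-- The mixed form `R^a_b` at `p` of a covariant two-tensor `R` at `p`. -/
noncomputable def LorentzianMetric.mixed (g : LorentzianMetric M) (p : M)
    (R : LinearMap.BilinForm ℝ (TangentSpace (𝓡 5) p)) :
    Module.End ℝ (TangentSpace (𝓡 5) p) :=
  SegreFive.mixed (g.form p) (g.signature p) R

end Manifold

end SegreFive

/-! Symmetry of `R` makes the mixed form `A` self-adjoint for `g`, so the theorem is linear algebra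
in Lorentz space. Reversing the sign of `g` along a time-like eigenvector gives a positive definite
form for which `A` stays self-adjoint, and the spectral theorem applies. Conversely, distinct
eigenspaces are `g`-orthogonal, so if they span, some component of a time-like vector is time-like.

On the orthogonal complement of a null vector `k`, `g` is nonnegative and vanishes only along `k`.
Hence independent null eigenvectors are not orthogonal, share their eigenvalue, and span a plane
with a time-like eigenvector. If the spectrum is real and `A` is not diagonalizable,
`exists_null_isEigenvector` finds a null eigenvector in the orthogonal complement of the sum of the
eigenspaces.

The three orthogonal eigenvectors are built separately for a time-like eigenvector, a null
eigenvector and a non-real eigenvalue. -/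

open scoped TensorProduct

namespace SegreFive

/-! ### Lorentz geometry: complements of time-like and null vectors -/

section Lorentz

variable {V : Type*} [AddCommGroup V] [Module ℝ V]

/-- Simultaneous diagonalization of a positive definite form and a symmetric form. -/
theorem exists_orthonormal_diagonalizing [FiniteDimensional ℝ V] {h r : LinearMap.BilinForm ℝ V}
    (hs : ∀ x y, h x y = h y x) (hp : ∀ x, x ≠ 0 → 0 < h x x) (rs : ∀ x y, r x y = r y x) :
    ∃ (b : Module.Basis (Fin (Module.finrank ℝ V)) ℝ V) (l : Fin (Module.finrank ℝ V) → ℝ),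
      (∀ i j, h (b i) (b j) = if i = j then 1 else 0) ∧ ∀ i x, r (b i) x = l i * h (b i) x := by
  let core : InnerProductSpace.Core ℝ V :=
    { inner := fun x y ↦ h x y
      conj_inner_symm := fun x y ↦ by simpa using hs y x
      re_inner_nonneg := fun x ↦ by
        by_cases hx : x = 0
        · simp [hx]
        · simpa using (hp x hx).le
      add_left := fun x y z ↦ by simp
      smul_left := fun x y c ↦ by simp
      definite := fun x hx ↦ by
        by_contra hne
        exact (hp x hne).ne' hx }
  let _ : NormedAddCommGroup V := core.toNormedAddCommGroup
  let _ : InnerProductSpace ℝ V := InnerProductSpace.ofCore core.toCore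
  have hin : ∀ x y : V, inner ℝ x y = h x y := fun _ _ ↦ rfl
  have hnd : h.Nondegenerate :=
    ⟨fun x hx ↦ by_contra fun hne ↦ (hp x hne).ne' (hx x),
      fun x hx ↦ by_contra fun hne ↦ (hp x hne).ne' (hx x)⟩
  let T : Module.End ℝ V := (h.toDual hnd).symm.toLinearMap ∘ₗ r
  have hT : ∀ x y, h (T x) y = r x y := fun x y ↦ by simp [T]
  have hsym : T.IsSymmetric := fun x y ↦ by
    rw [hin, hin, hT, hs, hT, rs]
  let b := hsym.eigenvectorBasis rfl
  refine ⟨b.toBasis, hsym.eigenvalues rfl, fun i j ↦ ?_, fun i x ↦ ?_⟩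
  · have := orthonormal_iff_ite.1 b.orthonormal i j
    simpa [hin] using this
  · have := hsym.apply_eigenvectorBasis rfl i
    rw [← hT, OrthonormalBasis.coe_toBasis]
    simp only [b]
    rw [this]
    simp

/-- `U` need not be invariant under the operator behind `r`, so `r` is controlled only against
vectors of `U`. -/
theorem exists_orthonormal_triple [FiniteDimensional ℝ V] {g r : LinearMap.BilinForm ℝ V}
    (hs : ∀ x y, g x y = g y x) (rs : ∀ x y, r x y = r y x) (U : Submodule ℝ V)
    (hU : 3 ≤ Module.finrank ℝ U) (hp : ∀ x ∈ U, x ≠ 0 → 0 < g x x) :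
    ∃ (b : Fin 3 → V) (l : Fin 3 → ℝ), (∀ i, b i ∈ U) ∧
      (∀ i j, g (b i) (b j) = if i = j then 1 else 0) ∧
      ∀ i, ∀ u ∈ U, r (b i) u = l i * g (b i) u := by
  obtain ⟨b, l, hb, hr⟩ := exists_orthonormal_diagonalizing (h := g.restrict U)
    (r := r.restrict U) (fun x y ↦ hs x y)
    (fun x hx ↦ hp x x.2 (fun h0 ↦ hx (Subtype.ext h0))) (fun x y ↦ rs x y)
  refine ⟨fun i ↦ b (Fin.castLE hU i), fun i ↦ l (Fin.castLE hU i), fun i ↦ (b _).2,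
    fun i j ↦ ?_, fun i u hu ↦ hr _ ⟨u, hu⟩⟩
  have := hb (Fin.castLE hU i) (Fin.castLE hU j)
  simpa using this

theorem three_le_finrank_ker_inf_ker [FiniteDimensional ℝ V] (hV : Module.finrank ℝ V = 5)
    (f f' : V →ₗ[ℝ] ℝ) : 3 ≤ Module.finrank ℝ ↥(LinearMap.ker f ⊓ LinearMap.ker f') := by
  rw [← LinearMap.ker_prod]
  have h1 := (f.prod f').finrank_range_add_finrank_ker
  have h2 := (LinearMap.range (f.prod f')).finrank_le
  simp at h2
  omega

variable {g : LinearMap.BilinForm ℝ V}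

theorem HasLorentzSignature.finrank_eq (hg : HasLorentzSignature g) : Module.finrank ℝ V = 5 := by
  obtain ⟨e, _⟩ := hg
  simp [Module.finrank_eq_card_basis e]

theorem HasLorentzSignature.exists_timelike (hg : HasLorentzSignature g) :
    ∃ e, g e e = -1 ∧ ∀ x, g e x = 0 → x ≠ 0 → 0 < g x x := by
  obtain ⟨e, he⟩ := hg
  refine ⟨e 0, by simp [he], fun x hx hne ↦ ?_⟩
  obtain ⟨c, rfl⟩ : ∃ c : Fin 5 → ℝ, x = ∑ i, c i • e i := ⟨e.repr x, (e.sum_repr x).symm⟩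
  have h0 : c 0 = 0 := by simpa [he] using hx
  have hxx : g (∑ i, c i • e i) (∑ i, c i • e i) = c 1 ^ 2 + c 2 ^ 2 + c 3 ^ 2 + c 4 ^ 2 := by
    simp [Fin.sum_univ_five, he, h0]
    ring
  rw [hxx]
  by_contra hle
  apply hne
  have hz : ∀ i, c i = 0 := by
    intro i
    fin_cases i
    · exact h0
    all_goals
      simp only [Fin.reduceFinMk, Fin.isValue]
      nlinarith [sq_nonneg (c 1), sq_nonneg (c 2), sq_nonneg (c 3), sq_nonneg (c 4)]
  simp [hz]

/-- Project `w` along `v` into the complement of the reference vector `e`. If `g w w ≤ 0`, the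
projection has nonpositive square, hence vanishes, and `w` is a multiple of `v` orthogonal to `v`.
-/
theorem pos_of_orthogonal_timelike (hg : HasLorentzSignature g) (hs : ∀ x y, g x y = g y x)
    {v w : V} (hv : g v v < 0) (hvw : g v w = 0) (hw : w ≠ 0) : 0 < g w w := by
  obtain ⟨e, he, hpos⟩ := hg.exists_timelike
  by_contra hle
  rw [not_lt] at hle
  have hv0 : v ≠ 0 := by rintro rfl; simp at hv
  have hve : g e v ≠ 0 := fun h ↦ by linarith [hpos v h hv0]
  set t := g e w / g e v with ht
  have horth : g e (w - t • v) = 0 := by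
    simp [ht, div_mul_cancel₀ _ hve]
  have hval : g (w - t • v) (w - t • v) = g w w + t ^ 2 * g v v := by
    simp [hs w v, hvw]
    ring
  have hz : w - t • v = 0 := by
    by_contra hne
    have := hpos _ horth hne
    nlinarith [sq_nonneg t]
  have hwv : w = t • v := sub_eq_zero.1 hz
  have : t = 0 := by
    rw [hwv] at hvw
    simpa [hv.ne] using hvw
  simp [this] at hwv
  exact hw hwv

/-- Projecting `w` along `k` into the complement of `e` leaves `g w w` unchanged, since `k` is null
and orthogonal to `w`. -/
theorem pos_or_mem_span_of_orthogonal_null (hg : HasLorentzSignature g)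
    (hs : ∀ x y, g x y = g y x) {k w : V} (hk : IsNull g k) (hkw : g k w = 0) :
    0 < g w w ∨ ∃ t : ℝ, w = t • k := by
  obtain ⟨e, he, hpos⟩ := hg.exists_timelike
  obtain ⟨hk0, hkk⟩ := hk
  have hke : g e k ≠ 0 := fun h ↦ (hpos k h hk0).ne' hkk
  set t := g e w / g e k with ht
  have horth : g e (w - t • k) = 0 := by
    simp [ht, div_mul_cancel₀ _ hke]
  have hval : g (w - t • k) (w - t • k) = g w w := by
    simp [hs w k, hkw, hkk]
  by_cases hz : w - t • k = 0
  · exact Or.inr ⟨t, sub_eq_zero.1 hz⟩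
  · exact Or.inl (hval ▸ hpos _ horth hz)

theorem nonneg_of_orthogonal_null (hg : HasLorentzSignature g)
    (hs : ∀ x y, g x y = g y x) {k w : V} (hk : IsNull g k) (hkw : g k w = 0) : 0 ≤ g w w := by
  rcases pos_or_mem_span_of_orthogonal_null hg hs hk hkw with h | ⟨t, rfl⟩
  · exact h.le
  · simp [hk.2]

end Lorentz

/-! ### Complex eigenvalues in terms of pairs of real vectors -/

section Complexification

variable {V : Type*} [AddCommGroup V] [Module ℝ V]

/-- The real part of a vector of the complexification. -/
noncomputable def rePart : ℂ ⊗[ℝ] V →ₗ[ℝ] V :=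
  (TensorProduct.lid ℝ V).toLinearMap ∘ₗ Complex.reLm.rTensor V

/-- The imaginary part of a vector of the complexification. -/
noncomputable def imPart : ℂ ⊗[ℝ] V →ₗ[ℝ] V :=
  (TensorProduct.lid ℝ V).toLinearMap ∘ₗ Complex.imLm.rTensor V

@[simp] theorem rePart_tmul (z : ℂ) (v : V) : rePart (z ⊗ₜ[ℝ] v) = z.re • v := by
  simp [rePart]

@[simp] theorem imPart_tmul (z : ℂ) (v : V) : imPart (z ⊗ₜ[ℝ] v) = z.im • v := by
  simp [imPart]

theorem tmul_rePart_add_tmul_imPart (w : ℂ ⊗[ℝ] V) :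
    (1 : ℂ) ⊗ₜ[ℝ] rePart w + Complex.I ⊗ₜ[ℝ] imPart w = w := by
  induction w using TensorProduct.induction_on with
  | zero => simp
  | tmul z v =>
    rw [rePart_tmul, imPart_tmul, ← TensorProduct.smul_tmul, ← TensorProduct.smul_tmul,
      ← TensorProduct.add_tmul]
    congr 1
    apply Complex.ext <;> simp
  | add w w' hw hw' =>
    conv_rhs => rw [← hw, ← hw']
    simp only [map_add, TensorProduct.tmul_add]
    abel

theorem rePart_smul (z : ℂ) (w : ℂ ⊗[ℝ] V) :
    rePart (z • w) = z.re • rePart w - z.im • imPart w := by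
  induction w using TensorProduct.induction_on with
  | zero => simp
  | tmul z' v => simp [TensorProduct.smul_tmul', sub_smul, mul_smul]
  | add w w' hw hw' => simp only [smul_add, map_add, hw, hw']; abel

theorem imPart_smul (z : ℂ) (w : ℂ ⊗[ℝ] V) :
    imPart (z • w) = z.im • rePart w + z.re • imPart w := by
  induction w using TensorProduct.induction_on with
  | zero => simp
  | tmul z' v => simp [TensorProduct.smul_tmul', add_smul, mul_smul, add_comm]
  | add w w' hw hw' => simp only [smul_add, map_add, hw, hw']; abel

theorem rePart_baseChange (A : Module.End ℝ V) (w : ℂ ⊗[ℝ] V) :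
    rePart (A.baseChange ℂ w) = A (rePart w) := by
  induction w using TensorProduct.induction_on with
  | zero => simp
  | tmul z v => simp
  | add w w' hw hw' => simp only [map_add, hw, hw']

theorem imPart_baseChange (A : Module.End ℝ V) (w : ℂ ⊗[ℝ] V) :
    imPart (A.baseChange ℂ w) = A (imPart w) := by
  induction w using TensorProduct.induction_on with
  | zero => simp
  | tmul z v => simp
  | add w w' hw hw' => simp only [map_add, hw, hw']

theorem hasEigenvalue_baseChange_iff (A : Module.End ℝ V) (z : ℂ) :
    Module.End.HasEigenvalue (A.baseChange ℂ) z ↔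
      ∃ x y : V, (x ≠ 0 ∨ y ≠ 0) ∧ A x = z.re • x - z.im • y ∧ A y = z.im • x + z.re • y := by
  constructor
  · intro h
    obtain ⟨w, hw⟩ := h.exists_hasEigenvector
    have hAw := hw.apply_eq_smul
    refine ⟨rePart w, imPart w, ?_, ?_, ?_⟩
    · by_contra! hc
      apply hw.2
      rw [← tmul_rePart_add_tmul_imPart w, hc.1, hc.2]
      simp
    · rw [← rePart_baseChange, hAw, rePart_smul]
    · rw [← imPart_baseChange, hAw, imPart_smul]
  · rintro ⟨x, y, hne, hx, hy⟩
    have key : ∀ w : ℂ ⊗[ℝ] V, rePart w = x → imPart w = y → A.baseChange ℂ w = z • w := by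
      intro w h1 h2
      rw [← tmul_rePart_add_tmul_imPart (A.baseChange ℂ w),
        ← tmul_rePart_add_tmul_imPart (z • w), rePart_baseChange, imPart_baseChange,
        rePart_smul, imPart_smul, h1, h2, hx, hy]
    set w : ℂ ⊗[ℝ] V := (1 : ℂ) ⊗ₜ[ℝ] x + Complex.I ⊗ₜ[ℝ] y with hw
    have h1 : rePart w = x := by simp [hw]
    have h2 : imPart w = y := by simp [hw]
    refine Module.End.hasEigenvalue_of_hasEigenvector (x := w)
      ⟨Module.End.mem_eigenspace_iff.2 (key w h1 h2), fun h0 ↦ ?_⟩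
    rw [h0, map_zero] at h1 h2
    rcases hne with h | h
    · exact h h1.symm
    · exact h h2.symm

/-- If `A` has real spectrum then every nonzero invariant subspace contains an eigenvector. -/
theorem AllEigenvaluesReal.exists_isEigenvector_mem [FiniteDimensional ℝ V] {A : Module.End ℝ V}
    (hA : AllEigenvaluesReal A) {W : Submodule ℝ V} (hW : W ≠ ⊥) (hinv : ∀ x ∈ W, A x ∈ W) :
    ∃ v ∈ W, IsEigenvector A v := by
  have : Nontrivial W := Submodule.nontrivial_iff_ne_bot.2 hW
  have : Nontrivial (ℂ ⊗[ℝ] W) := by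
    obtain ⟨x, hx⟩ := exists_ne (0 : W)
    refine ⟨⟨(1 : ℂ) ⊗ₜ[ℝ] x, 0, fun h ↦ hx ?_⟩⟩
    simpa using congrArg rePart h
  obtain ⟨z, hz⟩ := Module.End.exists_eigenvalue ((A.restrict hinv).baseChange ℂ)
  obtain ⟨x, y, hne, hx, hy⟩ := (hasEigenvalue_baseChange_iff _ z).1 hz
  have hx' : A x = z.re • (x : V) - z.im • (y : V) := congrArg Subtype.val hx
  have hy' : A y = z.im • (x : V) + z.re • (y : V) := congrArg Subtype.val hy
  -- An eigenvalue of the restriction is one of `A`, hence real; then `x` and `y` satisfy the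
  -- eigenvalue equation separately.
  have him : z.im = 0 := hA z ((hasEigenvalue_baseChange_iff A z).2
    ⟨x, y, by simpa using hne, hx', hy'⟩)
  rcases hne with h | h
  · exact ⟨x, x.2, z.re, Module.End.mem_eigenspace_iff.2 (by simp [hx', him]), by simpa using h⟩
  · exact ⟨y, y.2, z.re, Module.End.mem_eigenspace_iff.2 (by simp [hy', him]), by simpa using h⟩

end Complexification

end SegreFive

namespace SegreFive

/-! ### Self-adjoint operators: diagonalizability, real spectrum, null eigendirections -/

section SelfAdjoint

variable {V : Type*} [AddCommGroup V] [Module ℝ V]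
  {g : LinearMap.BilinForm ℝ V} {A : Module.End ℝ V}

theorem isEigenvector_of_apply_eq {μ : ℝ} {v : V} (h : A v = μ • v) (hv : v ≠ 0) :
    IsEigenvector A v :=
  ⟨μ, Module.End.mem_eigenspace_iff.2 h, hv⟩

theorem IsTimelike.ne_zero {v : V} (hv : IsTimelike g v) : v ≠ 0 := by
  rintro rfl
  simp [IsTimelike] at hv

theorem IsSpacelike.ne_zero {v : V} (hv : IsSpacelike g v) : v ≠ 0 := by
  rintro rfl
  simp [IsSpacelike] at hv

/-- The Riemannian form obtained from `g` by reversing the sign along a time-like vector `v`. -/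
noncomputable def reflectedForm (g : LinearMap.BilinForm ℝ V) (v : V) : LinearMap.BilinForm ℝ V :=
  g - (2 / g v v) • (LinearMap.mul ℝ ℝ).compl₁₂ (g v) (g v)

theorem reflectedForm_apply (g : LinearMap.BilinForm ℝ V) (v x y : V) :
    reflectedForm g v x y = g x y - 2 / g v v * (g v x * g v y) := by
  simp [reflectedForm]

/-- With `x = t • v + w` and `w` orthogonal to `v`, the value is `g w w - t ^ 2 * g v v`, a sum of
two nonnegative terms. -/
theorem reflectedForm_pos (hg : HasLorentzSignature g) (hs : ∀ x y, g x y = g y x) {v : V}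
    (hv : g v v < 0) {x : V} (hx : x ≠ 0) : 0 < reflectedForm g v x x := by
  rw [reflectedForm_apply]
  set t := g v x / g v v with ht
  have htv : g v x = t * g v v := by rw [ht, div_mul_cancel₀ _ hv.ne]
  have horth : g v (x - t • v) = 0 := by simp [htv]
  have hval : g (x - t • v) (x - t • v) = g x x - t ^ 2 * g v v := by
    simp [hs x v, htv]
    ring
  have hval' : g x x - 2 / g v v * (g v x * g v x) = g x x - 2 * t ^ 2 * g v v := by
    rw [htv]
    field_simp [hv.ne]
  rw [hval']
  by_cases hz : x - t • v = 0
  · have hxv := sub_eq_zero.1 hz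
    have ht0 : t ≠ 0 := by
      rintro h0
      rw [h0, zero_smul] at hxv
      exact hx hxv
    have h1 : g x x - t ^ 2 * g v v = 0 := by rw [← hval, hz]; simp
    nlinarith [mul_pos (pow_pos (abs_pos.2 ht0) 2) (neg_pos.2 hv), sq_abs t]
  · have := pos_of_orthogonal_timelike hg hs hv horth hz
    nlinarith [sq_nonneg t]

theorem reflectedForm_symm (hs : ∀ x y, g x y = g y x) (v x y : V) :
    reflectedForm g v x y = reflectedForm g v y x := by
  rw [reflectedForm_apply, reflectedForm_apply, hs x y, mul_comm (g v x)]

theorem reflectedForm_selfAdjoint (hA : ∀ x y, g (A x) y = g x (A y)) {v : V} {μ : ℝ}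
    (hμ : A v = μ • v) (x y : V) : reflectedForm g v (A x) y = reflectedForm g v x (A y) := by
  have h : ∀ z, g v (A z) = μ * g v z := fun z ↦ by rw [← hA, hμ]; simp
  rw [reflectedForm_apply, reflectedForm_apply, hA, h, h]
  ring

theorem isDiagonalizable_of_posDef [FiniteDimensional ℝ V] {h : LinearMap.BilinForm ℝ V}
    (hs : ∀ x y, h x y = h y x) (hp : ∀ x, x ≠ 0 → 0 < h x x)
    (hA : ∀ x y, h (A x) y = h x (A y)) : IsDiagonalizable A := by
  obtain ⟨b, l, -, hl⟩ := exists_orthonormal_diagonalizing (r := h ∘ₗ A) hs hp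
    (fun x y ↦ by simp [hA, hs x])
  refine ⟨b, fun i ↦ isEigenvector_of_apply_eq (μ := l i) ?_ (b.ne_zero i)⟩
  have h0 : ∀ x, h (A (b i) - l i • b i) x = 0 := fun x ↦ by
    have := hl i x
    simp only [LinearMap.comp_apply] at this
    simp [this]
  by_contra hne
  exact (hp _ (sub_ne_zero.2 hne)).ne' (h0 _)

theorem isDiagonalizable_of_timelike (hg : HasLorentzSignature g) (hs : ∀ x y, g x y = g y x)
    (hA : ∀ x y, g (A x) y = g x (A y)) {v : V} (hv : IsTimelike g v) (hev : IsEigenvector A v) :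
    IsDiagonalizable A := by
  have := hg.finiteDimensional
  obtain ⟨μ, hμ⟩ := hev
  exact isDiagonalizable_of_posDef (reflectedForm_symm hs v)
    (fun x hx ↦ reflectedForm_pos hg hs hv hx)
    (reflectedForm_selfAdjoint hA hμ.apply_eq_smul)

theorem eigenvectors_orthogonal (hA : ∀ x y, g (A x) y = g x (A y)) {x y : V} {a b : ℝ}
    (hab : a ≠ b) (hx : A x = a • x) (hy : A y = b • y) : g x y = 0 := by
  have := hA x y
  rw [hx, hy] at this
  simp only [map_smul, LinearMap.smul_apply, smul_eq_mul] at this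
  have h : (a - b) * g x y = 0 := by linear_combination this
  exact (mul_eq_zero.1 h).resolve_left (sub_ne_zero.2 hab)

theorem exists_timelike_isEigenvector_of_iSup_eq_top (hg : HasLorentzSignature g)
    (hA : ∀ x y, g (A x) y = g x (A y)) (htop : ⨆ μ, A.eigenspace μ = ⊤) :
    ∃ v, IsTimelike g v ∧ IsEigenvector A v := by
  obtain ⟨e, he, -⟩ := hg.exists_timelike
  have hmem : e ∈ ⨆ μ, A.eigenspace μ := htop ▸ Submodule.mem_top
  obtain ⟨f, hf, hsum⟩ := (Submodule.mem_iSup_iff_exists_finsupp _ _).1 hmem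
  have hf' : ∀ μ, A (f μ) = μ • f μ := fun μ ↦ Module.End.mem_eigenspace_iff.1 (hf μ)
  have hee : g e e = ∑ μ ∈ f.support, g (f μ) (f μ) := by
    rw [← hsum, Finsupp.sum, map_sum]
    refine Finset.sum_congr rfl fun μ hμ ↦ ?_
    rw [map_sum, LinearMap.sum_apply]
    exact Finset.sum_eq_single_of_mem μ hμ
      fun ν _ hν ↦ eigenvectors_orthogonal hA hν (hf' ν) (hf' μ)
  obtain ⟨μ, -, hμ⟩ : ∃ μ ∈ f.support, g (f μ) (f μ) < 0 := by
    by_contra! hc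
    have := Finset.sum_nonneg hc
    linarith
  have ht : IsTimelike g (f μ) := hμ
  exact ⟨f μ, ht, isEigenvector_of_apply_eq (hf' μ) ht.ne_zero⟩

theorem exists_timelike_iff_isDiagonalizable (hg : HasLorentzSignature g)
    (hs : ∀ x y, g x y = g y x) (hA : ∀ x y, g (A x) y = g x (A y)) :
    (∃ v, IsTimelike g v ∧ IsEigenvector A v) ↔ IsDiagonalizable A := by
  refine ⟨fun ⟨v, hv, hev⟩ ↦ isDiagonalizable_of_timelike hg hs hA hv hev, fun ⟨b, hb⟩ ↦ ?_⟩
  refine exists_timelike_isEigenvector_of_iSup_eq_top hg hA (top_le_iff.1 ?_)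
  rw [← b.span_eq, Submodule.span_le]
  rintro _ ⟨i, rfl⟩
  obtain ⟨μ, hμ⟩ := hb i
  exact Submodule.mem_iSup_of_mem μ hμ.1

/-- Self-adjointness for the reflected form, tested on the real and imaginary parts of an
eigenvector, gives `z.im` times a positive number equal to zero. -/
theorem allEigenvaluesReal_of_timelike (hg : HasLorentzSignature g)
    (hs : ∀ x y, g x y = g y x) (hA : ∀ x y, g (A x) y = g x (A y)) {v : V}
    (hv : IsTimelike g v) (hev : IsEigenvector A v) : AllEigenvaluesReal A := by
  intro z hz
  obtain ⟨μ, hμ⟩ := hev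
  obtain ⟨x, y, hne, hx, hy⟩ := (hasEigenvalue_baseChange_iff A z).1 hz
  have h1 := reflectedForm_selfAdjoint hA hμ.apply_eq_smul x y
  rw [hx, hy] at h1
  simp only [map_sub, map_add, map_smul, LinearMap.sub_apply, LinearMap.smul_apply,
    smul_eq_mul] at h1
  have h2 : z.im * (reflectedForm g v x x + reflectedForm g v y y) = 0 := by
    linear_combination -h1
  refine (mul_eq_zero.1 h2).resolve_right (ne_of_gt ?_)
  have hnn : ∀ u, 0 ≤ reflectedForm g v u u := fun u ↦ by
    by_cases hu : u = 0
    · simp [hu]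
    · exact (reflectedForm_pos hg hs hv hu).le
  rcases hne with h | h
  · exact add_pos_of_pos_of_nonneg (reflectedForm_pos hg hs hv h) (hnn y)
  · exact add_pos_of_nonneg_of_pos (hnn x) (reflectedForm_pos hg hs hv h)

/-- Two linearly independent null eigenvectors span a plane containing a time-like eigenvector. -/
theorem exists_timelike_isEigenvector_of_null_pair (hg : HasLorentzSignature g)
    (hs : ∀ x y, g x y = g y x) (hA : ∀ x y, g (A x) y = g x (A y)) {k n : V}
    (hk : IsNull g k) (hek : IsEigenvector A k) (hn : IsNull g n) (hen : IsEigenvector A n)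
    (hkn : ∀ t : ℝ, n ≠ t • k) : ∃ v, IsTimelike g v ∧ IsEigenvector A v := by
  obtain ⟨a, ha⟩ := hek
  obtain ⟨b, hb⟩ := hen
  have hne : g k n ≠ 0 := fun h ↦ by
    rcases pos_or_mem_span_of_orthogonal_null hg hs hk h with h | ⟨t, ht⟩
    · exact h.ne' hn.2
    · exact hkn t ht
  have hab : a = b := by
    by_contra hab
    exact hne (eigenvectors_orthogonal hA hab ha.apply_eq_smul hb.apply_eq_smul)
  -- Using `g k n` as the coefficient makes the square negative whatever the sign of `g k n`.
  have ht : IsTimelike g (n - g k n • k) := by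
    have : g (n - g k n • k) (n - g k n • k) = - (2 * g k n ^ 2) := by
      simp [hs n k, hk.2, hn.2]
      ring
    rw [IsTimelike, this]
    have := pow_pos (abs_pos.2 hne) 2
    rw [sq_abs] at this
    linarith
  refine ⟨_, ht, isEigenvector_of_apply_eq (μ := a) ?_ ht.ne_zero⟩
  rw [map_sub, map_smul, ha.apply_eq_smul, hb.apply_eq_smul, hab, smul_sub, smul_comm]

/-- The sum `S` of the eigenspaces and its orthogonal complement are invariant, and the complement
is nonzero unless `S` is everything. An eigenvector in the complement also lies in `S`, so it is
orthogonal to itself. -/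
theorem exists_null_isEigenvector (hg : HasLorentzSignature g) (hs : ∀ x y, g x y = g y x)
    (hA : ∀ x y, g (A x) y = g x (A y)) (hreal : AllEigenvaluesReal A)
    (hnd : ¬ IsDiagonalizable A) : ∃ k, IsNull g k ∧ IsEigenvector A k := by
  have := hg.finiteDimensional
  set S := ⨆ μ, A.eigenspace μ with hS
  have hinv : ∀ x ∈ S, A x ∈ S := by
    intro x hx
    refine Submodule.iSup_induction _ (motive := fun x ↦ A x ∈ S) hx ?_ (by simp) ?_
    · intro μ x hx
      rw [Module.End.mem_eigenspace_iff.1 hx]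
      exact S.smul_mem _ (Submodule.mem_iSup_of_mem μ hx)
    · intro x y hx hy
      rw [map_add]
      exact S.add_mem hx hy
  have hortho : ∀ x ∈ g.orthogonal S, A x ∈ g.orthogonal S := by
    intro x hx n hn
    have : g (A n) x = 0 := hx (A n) (hinv n hn)
    rwa [hA] at this
  have hrefl : g.IsRefl := fun x y h ↦ by rw [hs, h]
  have hbot : g.orthogonal S ≠ ⊥ := by
    intro hbot
    have hdim := LinearMap.BilinForm.finrank_orthogonal hg.nondegenerate S
    rw [hbot, finrank_bot] at hdim
    have htop : S = ⊤ := Submodule.eq_top_of_finrank_eq (by have := S.finrank_le; omega)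
    exact hnd ((exists_timelike_iff_isDiagonalizable hg hs hA).1
      (exists_timelike_isEigenvector_of_iSup_eq_top hg hA htop))
  obtain ⟨v, hv, μ, hμ⟩ := hreal.exists_isEigenvector_mem hbot hortho
  exact ⟨v, ⟨hμ.2, hv v (Submodule.mem_iSup_of_mem μ hμ.1)⟩, μ, hμ⟩

/-- For a non-real `z`, pairing with `k` multiplies `g k x + i * g k y` by both `z` and `μ`, so `x`
and `y` are orthogonal to `k`. Their squares are nonnegative with sum zero, so both are multiples of
`k`, forcing `z = μ`. -/
theorem allEigenvaluesReal_of_null (hg : HasLorentzSignature g) (hs : ∀ x y, g x y = g y x)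
    (hA : ∀ x y, g (A x) y = g x (A y)) {k : V} (hk : IsNull g k) (hek : IsEigenvector A k) :
    AllEigenvaluesReal A := by
  intro z hz
  by_contra him
  obtain ⟨μ, hμ⟩ := hek
  obtain ⟨x, y, hne, hx, hy⟩ := (hasEigenvalue_baseChange_iff A z).1 hz
  have hAk : ∀ w, g k (A w) = μ * g k w := fun w ↦ by rw [← hA, hμ.apply_eq_smul]; simp
  have h1 := hAk x
  have h2 := hAk y
  have h3 := hA x y
  rw [hx] at h1 h3
  rw [hy] at h2 h3
  simp only [map_sub, map_add, map_smul, LinearMap.sub_apply, LinearMap.smul_apply,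
    smul_eq_mul] at h1 h2 h3
  have hsum : g x x + g y y = 0 := by
    have : z.im * (g x x + g y y) = 0 := by linear_combination -h3
    exact (mul_eq_zero.1 this).resolve_left him
  -- This is the squared modulus of `z - μ`; multiplying by the conjugate of `z - μ` isolates each
  -- unknown.
  have hpos : 0 < (z.re - μ) ^ 2 + z.im ^ 2 := by positivity
  have hkx : g k x = 0 := by
    have : ((z.re - μ) ^ 2 + z.im ^ 2) * g k x = 0 := by
      linear_combination (z.re - μ) * h1 + z.im * h2
    exact (mul_eq_zero.1 this).resolve_left hpos.ne'
  have hky : g k y = 0 := by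
    have : ((z.re - μ) ^ 2 + z.im ^ 2) * g k y = 0 := by
      linear_combination (z.re - μ) * h2 - z.im * h1
    exact (mul_eq_zero.1 this).resolve_left hpos.ne'
  have hxn := nonneg_of_orthogonal_null hg hs hk hkx
  have hyn := nonneg_of_orthogonal_null hg hs hk hky
  have hAx : A x = μ • x := by
    rcases pos_or_mem_span_of_orthogonal_null hg hs hk hkx with h | ⟨t, rfl⟩
    · linarith
    · rw [map_smul, hμ.apply_eq_smul, smul_comm]
  have hAy : A y = μ • y := by
    rcases pos_or_mem_span_of_orthogonal_null hg hs hk hky with h | ⟨t, rfl⟩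
    · linarith
    · rw [map_smul, hμ.apply_eq_smul, smul_comm]
  rw [hAx] at hx
  rw [hAy] at hy
  have ex : ((z.re - μ) ^ 2 + z.im ^ 2) • x = 0 := by
    have hx' : (z.re - μ) • x = z.im • y := by
      rw [sub_smul, hx]; abel
    have hy' : z.im • x = - ((z.re - μ) • y) := by
      rw [sub_smul, hy]; abel
    rw [add_smul, pow_two, pow_two, mul_smul, mul_smul, hx', hy', smul_neg, smul_comm]
    abel
  have ey : ((z.re - μ) ^ 2 + z.im ^ 2) • y = 0 := by
    have hx' : z.im • y = (z.re - μ) • x := by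
      rw [sub_smul, hx]; abel
    have hy' : (z.re - μ) • y = - (z.im • x) := by
      rw [sub_smul, hy]; abel
    rw [add_smul, pow_two, pow_two, mul_smul, mul_smul, hx', hy', smul_neg, smul_comm]
    abel
  rcases hne with h | h
  · exact h ((smul_eq_zero.1 ex).resolve_left hpos.ne')
  · exact h ((smul_eq_zero.1 ey).resolve_left hpos.ne')

/-- A time-like and a null eigenvector share their eigenvalue, and the reflection of the null
one is another null eigendirection. -/
theorem exists_null_isEigenvector_of_timelike (hg : HasLorentzSignature g)
    (hs : ∀ x y, g x y = g y x) (hA : ∀ x y, g (A x) y = g x (A y)) {k v : V}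
    (hk : IsNull g k) (hek : IsEigenvector A k) (hv : IsTimelike g v) (hev : IsEigenvector A v) :
    ∃ n, IsNull g n ∧ IsEigenvector A n ∧ ∀ t : ℝ, n ≠ t • k := by
  obtain ⟨a, ha⟩ := hek
  obtain ⟨b, hb⟩ := hev
  have hvv : g v v ≠ 0 := ne_of_lt hv
  have hne : g v k ≠ 0 := fun h ↦ (pos_of_orthogonal_timelike hg hs hv h hk.1).ne' hk.2
  have hab : b = a := by
    by_contra hab
    exact hne (eigenvectors_orthogonal hA hab hb.apply_eq_smul ha.apply_eq_smul)
  set c := 2 * g v k / g v v with hc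
  have hcv : c * g v v = 2 * g v k := by rw [hc, div_mul_cancel₀ _ hvv]
  have hc0 : c ≠ 0 := by
    rw [hc]
    positivity
  have hvspan : ∀ t : ℝ, k - c • v ≠ t • k := by
    intro t ht
    have h1 : c • v = (1 - t) • k := by rw [sub_smul, one_smul, ← ht]; abel
    have h2 := congrArg (fun w ↦ g w w) h1
    simp [hk.2, hc0, hvv] at h2
  refine ⟨k - c • v, ⟨fun h ↦ hvspan 0 (by rw [h, zero_smul]), ?_⟩, ?_, hvspan⟩
  · simp only [map_sub, map_smul, LinearMap.sub_apply, LinearMap.smul_apply, smul_eq_mul,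
      hs k v, hk.2]
    linear_combination c * hcv
  · refine isEigenvector_of_apply_eq (μ := a) ?_ fun h ↦ hvspan 0 (by rw [h, zero_smul])
    rw [map_sub, map_smul, ha.apply_eq_smul, hb.apply_eq_smul, hab, smul_sub, smul_comm]

theorem real_and_not_isDiagonalizable_iff (hg : HasLorentzSignature g)
    (hs : ∀ x y, g x y = g y x) (hA : ∀ x y, g (A x) y = g x (A y)) :
    (AllEigenvaluesReal A ∧ ¬ IsDiagonalizable A) ↔ ∃! L, IsNullEigendirection g A L := by
  constructor
  · rintro ⟨hreal, hnd⟩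
    obtain ⟨k, hk, hek⟩ := exists_null_isEigenvector hg hs hA hreal hnd
    refine ⟨Submodule.span ℝ {k}, ⟨k, hk, hek, rfl⟩, ?_⟩
    rintro _ ⟨n, hn, hen, rfl⟩
    obtain ⟨t, rfl⟩ : ∃ t : ℝ, n = t • k := by
      by_contra! hkn
      exact hnd ((exists_timelike_iff_isDiagonalizable hg hs hA).1
        (exists_timelike_isEigenvector_of_null_pair hg hs hA hk hek hn hen hkn))
    have ht : t ≠ 0 := by
      rintro rfl
      exact hn.1 (zero_smul ℝ k)
    exact Submodule.span_singleton_smul_eq ht.isUnit k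
  · rintro ⟨L, ⟨k, hk, hek, rfl⟩, huniq⟩
    refine ⟨allEigenvaluesReal_of_null hg hs hA hk hek, fun hd ↦ ?_⟩
    obtain ⟨v, hv, hev⟩ := (exists_timelike_iff_isDiagonalizable hg hs hA).2 hd
    obtain ⟨n, hn, hen, hkn⟩ := exists_null_isEigenvector_of_timelike hg hs hA hk hek hv hev
    have hmem : n ∈ Submodule.span ℝ {k} :=
      huniq _ ⟨n, hn, hen, rfl⟩ ▸ Submodule.mem_span_singleton_self n
    obtain ⟨t, ht⟩ := Submodule.mem_span_singleton.1 hmem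
    exact hkn t ht.symm

end SelfAdjoint

end SegreFive

namespace SegreFive

/-! ### Three orthogonal eigenvectors -/

section ThreeEigenvectors

variable {V : Type*} [AddCommGroup V] [Module ℝ V]
  {g : LinearMap.BilinForm ℝ V} {A : Module.End ℝ V}

/-- `A` has three independent orthogonal eigenvectors, two of them space-like. -/
def HasThreeOrthogonalEigenvectors (g : LinearMap.BilinForm ℝ V) (A : Module.End ℝ V) : Prop :=
  ∃ u : Fin 3 → V, LinearIndependent ℝ u ∧ (∀ i, IsEigenvector A (u i)) ∧
    (∀ i j, i ≠ j → g (u i) (u j) = 0) ∧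
    ∃ i j, i ≠ j ∧ IsSpacelike g (u i) ∧ IsSpacelike g (u j)

/-- The vector `k` may be of any causal type: pairing with `x` and `y` kills their coefficients, and
`k` being nonzero kills the last. -/
theorem hasThreeOrthogonalEigenvectors_of_orthogonal (hs : ∀ x y, g x y = g y x) {k x y : V}
    (hk : IsEigenvector A k) (hx : IsEigenvector A x) (hy : IsEigenvector A y)
    (hsx : IsSpacelike g x) (hsy : IsSpacelike g y) (hkx : g k x = 0) (hky : g k y = 0)
    (hxy : g x y = 0) : HasThreeOrthogonalEigenvectors g A := by
  have hk0 : k ≠ 0 := by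
    obtain ⟨μ, hμ⟩ := hk
    exact hμ.2
  refine ⟨![k, x, y], ?_, ?_, ?_, 1, 2, by decide, hsx, hsy⟩
  · rw [Fintype.linearIndependent_iff]
    intro c hc
    simp only [Fin.sum_univ_three, Matrix.cons_val] at hc
    have h1 : c 1 = 0 := by
      have := congrArg (fun w ↦ g w x) hc
      simpa [hkx, hs y x, hxy, (ne_of_gt hsx : g x x ≠ 0)] using this
    have h2 : c 2 = 0 := by
      have := congrArg (fun w ↦ g w y) hc
      simpa [hky, hxy, (ne_of_gt hsy : g y y ≠ 0)] using this
    have h0 : c 0 = 0 := by simpa [h1, h2, hk0] using hc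
    intro i
    fin_cases i <;> assumption
  · intro i
    fin_cases i <;> assumption
  · intro i j hij
    fin_cases i <;> fin_cases j <;> first | exact absurd rfl hij | skip
    · exact hkx
    · exact hky
    · exact (hs _ _).trans hkx
    · exact hxy
    · exact (hs _ _).trans hky
    · exact (hs _ _).trans hxy

theorem hasThreeOrthogonalEigenvectors_of_invariant [FiniteDimensional ℝ V]
    (hs : ∀ x y, g x y = g y x) (hA : ∀ x y, g (A x) y = g x (A y)) (U : Submodule ℝ V)
    (hU : 3 ≤ Module.finrank ℝ U) (hp : ∀ x ∈ U, x ≠ 0 → 0 < g x x)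
    (hinv : ∀ x ∈ U, A x ∈ U) : HasThreeOrthogonalEigenvectors g A := by
  obtain ⟨b, l, hbU, hb, hl⟩ := exists_orthonormal_triple (r := g ∘ₗ A) hs
    (fun x y ↦ by simp [hA, hs x]) U hU hp
  have hsp : ∀ i, IsSpacelike g (b i) := fun i ↦ by simp [IsSpacelike, hb]
  have hev : ∀ i, IsEigenvector A (b i) := fun i ↦ by
    refine isEigenvector_of_apply_eq (μ := l i) ?_ (hsp i).ne_zero
    by_contra hne
    have hmem : A (b i) - l i • b i ∈ U := U.sub_mem (hinv _ (hbU i)) (U.smul_mem _ (hbU i))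
    have h0 := hl i _ hmem
    rw [LinearMap.comp_apply] at h0
    refine (hp _ hmem (sub_ne_zero.2 hne)).ne' ?_
    rw [map_sub g, LinearMap.sub_apply, h0]
    simp
  exact hasThreeOrthogonalEigenvectors_of_orthogonal hs (hev 0) (hev 1) (hev 2) (hsp 1) (hsp 2)
    (by simp [hb]) (by simp [hb]) (by simp [hb])

theorem hasThreeOrthogonalEigenvectors_of_timelike (hg : HasLorentzSignature g)
    (hs : ∀ x y, g x y = g y x) (hA : ∀ x y, g (A x) y = g x (A y)) {v : V}
    (hv : IsTimelike g v) (hev : IsEigenvector A v) : HasThreeOrthogonalEigenvectors g A := by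
  have := hg.finiteDimensional
  obtain ⟨μ, hμ⟩ := hev
  refine hasThreeOrthogonalEigenvectors_of_invariant hs hA _
    -- The functional is repeated: the subspace is just the orthogonal complement of `v`.
    (three_le_finrank_ker_inf_ker hg.finrank_eq (g v) (g v)) ?_ ?_
  · rintro x ⟨hx, -⟩ hne
    exact pos_of_orthogonal_timelike hg hs hv hx hne
  · rintro x ⟨hx, -⟩
    have : g v (A x) = 0 := by
      rw [← hA, hμ.apply_eq_smul, map_smul, LinearMap.smul_apply, LinearMap.mem_ker.1 hx,
        smul_zero]
    exact ⟨this, this⟩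

/-- The real and imaginary parts `x`, `y` of a complex eigenvector span an invariant subspace, so
its complement is invariant too. As `g x x + g y y = 0`, either one of them is time-like or both are
null. -/
theorem hasThreeOrthogonalEigenvectors_of_not_real (hg : HasLorentzSignature g)
    (hs : ∀ x y, g x y = g y x) (hA : ∀ x y, g (A x) y = g x (A y))
    (hreal : ¬ AllEigenvaluesReal A) : HasThreeOrthogonalEigenvectors g A := by
  have := hg.finiteDimensional
  have hnull : ∀ k, IsNull g k → ¬ IsEigenvector A k := fun k hk hek ↦
    hreal (allEigenvaluesReal_of_null hg hs hA hk hek)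
  rw [AllEigenvaluesReal] at hreal
  push Not at hreal
  obtain ⟨z, hz, him⟩ := hreal
  obtain ⟨x, y, hne, hx, hy⟩ := (hasEigenvalue_baseChange_iff A z).1 hz
  have hsum : g x x + g y y = 0 := by
    have h3 := hA x y
    rw [hx, hy] at h3
    simp only [map_sub, map_add, map_smul, LinearMap.sub_apply, LinearMap.smul_apply,
      smul_eq_mul] at h3
    have : z.im * (g x x + g y y) = 0 := by linear_combination -h3
    exact (mul_eq_zero.1 this).resolve_left him
  have hx0 : x ≠ 0 := by
    rintro rfl
    have : y = 0 := by simpa [him] using hx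
    simp [this] at hne
  refine hasThreeOrthogonalEigenvectors_of_invariant hs hA _
    (three_le_finrank_ker_inf_ker hg.finrank_eq (g x) (g y)) ?_ ?_
  · rintro u ⟨hxu, hyu⟩ hu
    replace hxu : g x u = 0 := hxu
    replace hyu : g y u = 0 := hyu
    rcases lt_trichotomy (g x x) 0 with h | h | h
    · exact pos_of_orthogonal_timelike hg hs h hxu hu
    · rcases pos_or_mem_span_of_orthogonal_null hg hs ⟨hx0, h⟩ hxu with h' | ⟨t, rfl⟩
      · exact h'
      have ht : t ≠ 0 := by
        rintro rfl
        simp at hu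
      -- A bad `u` is a multiple of `x`, so `x` is orthogonal to `y`. Then `y` is a multiple of `x`,
      -- making `x` a null eigenvector, which is excluded.
      have hxy : g x y = 0 := by
        rw [hs]
        simpa [ht] using hyu
      exfalso
      rcases pos_or_mem_span_of_orthogonal_null hg hs ⟨hx0, h⟩ hxy with h' | ⟨s, rfl⟩
      · linarith
      · refine hnull x ⟨hx0, h⟩ (isEigenvector_of_apply_eq (μ := z.re - z.im * s) ?_ hx0)
        rw [hx, sub_smul, mul_smul]
    · exact pos_of_orthogonal_timelike hg hs (by linarith) hyu hu
  · rintro u ⟨hxu, hyu⟩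
    replace hxu : g x u = 0 := hxu
    replace hyu : g y u = 0 := hyu
    refine ⟨?_, ?_⟩
    · change g x (A u) = 0
      rw [← hA, hx]
      simp [hxu, hyu]
    · change g y (A u) = 0
      rw [← hA, hy]
      simp [hxu, hyu]

/-- An eigenvector in the orthogonal complement of a null eigenvector `k` modulo `k` can be
shifted along `k` so that the defect vanishes unless the eigenvalue is that of `k`. -/
theorem exists_shift_of_null {μ l c : ℝ} {k x : V} (hμ : A k = μ • k)
    (hx : A x = l • x + c • k) :
    ∃ t c' : ℝ, A (x + t • k) = l • (x + t • k) + c' • k ∧ (c' = 0 ∨ l = μ) := by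
  by_cases hl : l = μ
  · exact ⟨0, c, by simpa using hx, Or.inr hl⟩
  -- The defect after the shift is `c - t * (l - μ)`.
  · refine ⟨c / (l - μ), 0, ?_, Or.inl rfl⟩
    have h : (l - μ) * (c / (l - μ)) = c := mul_div_cancel₀ _ (sub_ne_zero.2 hl)
    rw [map_add, map_smul, hx, hμ]
    nth_rw 1 [← h]
    module

/-- If `A` maps each vector of an orthonormal triple to a multiple of itself up to a defect along
`k`, and the defects vanish for eigenvalues other than `μ`, then two orthogonal
space-like eigenvectors lie in the span of the triple. -/
theorem exists_spacelike_pair_of_defects {k : V} {μ : ℝ} {b : Fin 3 → V} {l c : Fin 3 → ℝ}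
    (hb : ∀ i j, g (b i) (b j) = if i = j then 1 else 0) (hkb : ∀ i, g k (b i) = 0)
    (hAb : ∀ i, A (b i) = l i • b i + c i • k) (hc : ∀ i, c i = 0 ∨ l i = μ) :
    ∃ x y, IsEigenvector A x ∧ IsEigenvector A y ∧ IsSpacelike g x ∧ IsSpacelike g y ∧
      g k x = 0 ∧ g k y = 0 ∧ g x y = 0 := by
  have hsp : ∀ i, IsSpacelike g (b i) := fun i ↦ by simp [IsSpacelike, hb]
  have single : ∀ i, c i = 0 → IsEigenvector A (b i) := fun i hi ↦
    isEigenvector_of_apply_eq (μ := l i) (by rw [hAb, hi]; simp) (hsp i).ne_zero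
  -- The combination `c j • b i - c i • b j` cancels the two defects along `k`.
  have hspp : ∀ i j, i ≠ j → c i ≠ 0 → IsSpacelike g (c j • b i - c i • b j) := by
    intro i j hij hi
    have : g (c j • b i - c i • b j) (c j • b i - c i • b j) = c j ^ 2 + c i ^ 2 := by
      simp [hb, hij, hij.symm]
      ring
    rw [IsSpacelike, this]
    positivity
  have pair : ∀ i j, i ≠ j → c i ≠ 0 → c j ≠ 0 → IsEigenvector A (c j • b i - c i • b j) := by
    intro i j hij hi hj
    refine isEigenvector_of_apply_eq (μ := μ) ?_ (hspp i j hij hi).ne_zero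
    rw [map_sub, map_smul, map_smul, hAb, hAb, (hc i).resolve_left hi, (hc j).resolve_left hj]
    module
  have two : ∀ i j, i ≠ j → c i = 0 → c j = 0 → ∃ x y, IsEigenvector A x ∧ IsEigenvector A y ∧
      IsSpacelike g x ∧ IsSpacelike g y ∧ g k x = 0 ∧ g k y = 0 ∧ g x y = 0 :=
    fun i j hij hi hj ↦ ⟨b i, b j, single i hi, single j hj, hsp i, hsp j, hkb i, hkb j,
      by simp [hb, hij]⟩
  have one : ∀ m i j, m ≠ i → m ≠ j → i ≠ j → c m = 0 → c i ≠ 0 → c j ≠ 0 →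
      ∃ x y, IsEigenvector A x ∧ IsEigenvector A y ∧
      IsSpacelike g x ∧ IsSpacelike g y ∧ g k x = 0 ∧ g k y = 0 ∧ g x y = 0 :=
    fun m i j hmi hmj hij hm hi hj ↦ ⟨b m, c j • b i - c i • b j, single m hm,
      pair i j hij hi hj, hsp m, hspp i j hij hi, hkb m, by simp [hkb], by simp [hb, hmi, hmj]⟩
  by_cases h0 : c 0 = 0
  · by_cases h1 : c 1 = 0
    · exact two 0 1 (by decide) h0 h1
    by_cases h2 : c 2 = 0
    · exact two 0 2 (by decide) h0 h2
    exact one 0 1 2 (by decide) (by decide) (by decide) h0 h1 h2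
  by_cases h1 : c 1 = 0
  · by_cases h2 : c 2 = 0
    · exact two 1 2 (by decide) h1 h2
    exact one 1 0 2 (by decide) (by decide) (by decide) h1 h0 h2
  by_cases h2 : c 2 = 0
  · exact one 2 0 1 (by decide) (by decide) (by decide) h2 h0 h1
  -- The coefficients are the cross product of `(c 0, c 1, c 2)` with `(c 1, -c 0, 0)`: the defects
  -- cancel and the vector is orthogonal to the first pair.
  have hs2 : IsSpacelike g
      ((c 0 * c 2) • b 0 + (c 1 * c 2) • b 1 - (c 0 ^ 2 + c 1 ^ 2) • b 2) := by
    have : g ((c 0 * c 2) • b 0 + (c 1 * c 2) • b 1 - (c 0 ^ 2 + c 1 ^ 2) • b 2)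
        ((c 0 * c 2) • b 0 + (c 1 * c 2) • b 1 - (c 0 ^ 2 + c 1 ^ 2) • b 2) =
        (c 0 * c 2) ^ 2 + (c 1 * c 2) ^ 2 + (c 0 ^ 2 + c 1 ^ 2) ^ 2 := by
      simp [hb]
      ring
    rw [IsSpacelike, this]
    positivity
  refine ⟨_, _, pair 0 1 (by decide) h0 h1, isEigenvector_of_apply_eq (μ := μ) ?_ hs2.ne_zero,
    hspp 0 1 (by decide) h0, hs2, by simp [hkb], by simp [hkb], ?_⟩
  · simp only [map_sub, map_add, map_smul, hAb, (hc 0).resolve_left h0, (hc 1).resolve_left h1,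
      (hc 2).resolve_left h2]
    module
  · simp [hb]
    ring

/-- The complement of `k` and `e` is positive definite but perhaps not invariant, so `A` is
diagonalized there only modulo `k`. The defects are removed by shifts along `k` and by linear
combinations. -/
theorem hasThreeOrthogonalEigenvectors_of_null (hg : HasLorentzSignature g)
    (hs : ∀ x y, g x y = g y x) (hA : ∀ x y, g (A x) y = g x (A y)) {k : V}
    (hk : IsNull g k) (hek : IsEigenvector A k) : HasThreeOrthogonalEigenvectors g A := by
  have := hg.finiteDimensional
  obtain ⟨e, -, hpos⟩ := hg.exists_timelike
  have hek' := hek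
  obtain ⟨μ, hμ⟩ := hek'
  obtain ⟨hk0, hkk⟩ := hk
  have hke : g e k ≠ 0 := fun h ↦ (hpos k h hk0).ne' hkk
  obtain ⟨b, l, hbU, hb, hl⟩ := exists_orthonormal_triple (r := g ∘ₗ A) hs
    (fun x y ↦ by simp [hA, hs x]) _
    (three_le_finrank_ker_inf_ker hg.finrank_eq (g k) (g e)) fun x hx hne ↦ hpos x hx.2 hne
  have hkb : ∀ i, g k (b i) = 0 := fun i ↦ (hbU i).1
  have hdefect : ∀ i, ∃ c : ℝ, A (b i) = l i • b i + c • k := by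
    intro i
    set w := A (b i) - l i • b i with hw
    have hkw : g k w = 0 := by
      simp [hw, ← hA, hμ.apply_eq_smul, hkb]
    set c := g e w / g e k with hc
    have hmem : w - c • k ∈ LinearMap.ker (g k) ⊓ LinearMap.ker (g e) := by
      refine ⟨?_, ?_⟩
      · change g k (w - c • k) = 0
        simp [hkw, hkk]
      · change g e (w - c • k) = 0
        simp [hc, div_mul_cancel₀ _ hke]
    -- Both `w` and `k` are orthogonal to this vector, which lies in a positive definite subspace.
    have hval : g (w - c • k) (w - c • k) = 0 := by
      have h1 : g w (w - c • k) = 0 := by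
        have := hl i _ hmem
        rw [LinearMap.comp_apply] at this
        rw [show g w = g (A (b i)) - l i • g (b i) by rw [hw, map_sub, map_smul],
          LinearMap.sub_apply, this, LinearMap.smul_apply, smul_eq_mul, sub_self]
      have h2 : g k (w - c • k) = 0 := hmem.1
      rw [map_sub g, LinearMap.sub_apply, h1, map_smul g, LinearMap.smul_apply, h2]
      simp
    have hz : w - c • k = 0 := by
      by_contra hne
      exact (hpos _ hmem.2 hne).ne' hval
    refine ⟨c, ?_⟩
    rw [← sub_eq_zero.1 hz, hw]
    abel
  choose c hc using hdefect
  choose t c' hAb hc' using fun i ↦ exists_shift_of_null hμ.apply_eq_smul (hc i)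
  obtain ⟨x, y, hx, hy, hsx, hsy, hkx, hky, hxy⟩ :=
    -- Shifts along `k` keep the triple orthonormal, `k` being null and orthogonal to it.
    exists_spacelike_pair_of_defects (g := g) (k := k) (b := fun i ↦ b i + t i • k)
      (fun i j ↦ by simp [hkb, hkk, hs _ k, hb]) (fun i ↦ by simp [hkb, hkk]) hAb hc'
  exact hasThreeOrthogonalEigenvectors_of_orthogonal hs hek hx hy hsx hsy hkx hky hxy

theorem hasThreeOrthogonalEigenvectors (hg : HasLorentzSignature g)
    (hs : ∀ x y, g x y = g y x) (hA : ∀ x y, g (A x) y = g x (A y)) :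
    HasThreeOrthogonalEigenvectors g A := by
  by_cases hreal : AllEigenvaluesReal A
  · by_cases hd : IsDiagonalizable A
    · obtain ⟨v, hv, hev⟩ := (exists_timelike_iff_isDiagonalizable hg hs hA).2 hd
      exact hasThreeOrthogonalEigenvectors_of_timelike hg hs hA hv hev
    · obtain ⟨k, hk, hek⟩ := exists_null_isEigenvector hg hs hA hreal hd
      exact hasThreeOrthogonalEigenvectors_of_null hg hs hA hk hek
  · exact hasThreeOrthogonalEigenvectors_of_not_real hg hs hA hreal

theorem mixed_selfAdjoint (hg : HasLorentzSignature g) (hs : ∀ x y, g x y = g y x)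
    {R : LinearMap.BilinForm ℝ V} (hR : R.IsSymm) (x y : V) :
    g (mixed g hg R x) y = g x (mixed g hg R y) := by
  rw [mixed_spec, hs, mixed_spec, hR.eq]

end ThreeEigenvectors

end SegreFive

theorem theorem2 {M : Type*} [TopologicalSpace M]
    [ChartedSpace (EuclideanSpace ℝ (Fin 5)) M] [IsManifold (𝓡 5) ∞ M]
    (g : SegreFive.LorentzianMetric M) (p : M)
    (R : LinearMap.BilinForm ℝ (TangentSpace (𝓡 5) p)) (hR : R.IsSymm) :
    -- a time-like eigenvector exists iff the mixed form is diagonalizable over the reals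
    ((∃ v, SegreFive.IsTimelike (g.form p) v ∧ SegreFive.IsEigenvector (g.mixed p R) v) ↔
      SegreFive.IsDiagonalizable (g.mixed p R)) ∧
    -- three independent orthogonal real eigenvectors, two of them (at least) space-like
    (∃ u : Fin 3 → TangentSpace (𝓡 5) p,
      LinearIndependent ℝ u ∧
      (∀ i, SegreFive.IsEigenvector (g.mixed p R) (u i)) ∧
      (∀ i j, i ≠ j → g.form p (u i) (u j) = 0) ∧
      ∃ i j, i ≠ j ∧ SegreFive.IsSpacelike (g.form p) (u i) ∧
        SegreFive.IsSpacelike (g.form p) (u j)) ∧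
    -- real spectrum and not diagonalizable iff there is a unique null eigendirection
    ((SegreFive.AllEigenvaluesReal (g.mixed p R) ∧
        ¬ SegreFive.IsDiagonalizable (g.mixed p R)) ↔
      ∃! L : Submodule ℝ (TangentSpace (𝓡 5) p),
        SegreFive.IsNullEigendirection (g.form p) (g.mixed p R) L) ∧
    -- two independent null eigenvectors force real diagonalizability and real eigenvalues
    ((∃ k n : TangentSpace (𝓡 5) p,
        SegreFive.IsNull (g.form p) k ∧ SegreFive.IsEigenvector (g.mixed p R) k ∧
        SegreFive.IsNull (g.form p) n ∧ SegreFive.IsEigenvector (g.mixed p R) n ∧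
        LinearIndependent ℝ ![k, n]) →
      SegreFive.IsDiagonalizable (g.mixed p R) ∧
        SegreFive.AllEigenvaluesReal (g.mixed p R)) := by
  have hs : ∀ x y, g.form p x y = g.form p y x := g.symm p
  have hg : SegreFive.HasLorentzSignature (g.form p) := g.signature p
  have hA : ∀ x y, g.form p (g.mixed p R x) y = g.form p x (g.mixed p R y) :=
    SegreFive.mixed_selfAdjoint hg hs hR
  refine ⟨SegreFive.exists_timelike_iff_isDiagonalizable hg hs hA,
    SegreFive.hasThreeOrthogonalEigenvectors hg hs hA,
    SegreFive.real_and_not_isDiagonalizable_iff hg hs hA, ?_⟩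
  rintro ⟨k, n, hk, hek, hn, hen, hli⟩
  have hkn : ∀ t : ℝ, n ≠ t • k := fun t ht ↦
    (LinearIndependent.pair_iff' hk.1).1 hli t ht.symm
  obtain ⟨v, hv, hev⟩ :=
    SegreFive.exists_timelike_isEigenvector_of_null_pair hg hs hA hk hek hn hen hkn
  exact ⟨SegreFive.isDiagonalizable_of_timelike hg hs hA hv hev,
    SegreFive.allEigenvaluesReal_of_timelike hg hs hA hv hev⟩
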